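/- **Theorem 3.4.** Let $\Pi^{N}=\{z\in\mathbb C^{N}:\operatorname{Re}z_1>0,\dots,\operatorname{Re}z_N>0\}$. A rational $m\times m$ matrix-valued function $f$ of $N$ complex variables belongs to the class $\mathbb{R}\mathcal P_N^{m\times m}$ (is *positive real*) if (i) $\overline{f(\bar z)}=f(z)$; (ii) $f(z)^T=f(z)$; (iii) $f(\lambda z)=\lambda f(z)$ for all $\lambda\in\mathbb C\setminus\{0\}$; (iv) $f(z)+f(z)^*\ge 0$ (positive semidefinite) for $z\in\Pi^N$; (v) $f$ is holomorphic on $\Pi^N$. Identities and inequalities between values are understood at points where $f$ is defined. Write $(z_0,z)=(z_0,z_1,\dots,z_d)$. For an integer $n\ge 0$ and a polynomial $p(z_0,z)=\sum_{k=0}^{n}p_k(z)z_0^k$ of degree at most $n$ in $z_0$, the degree reduction (polarization) operator is $$D^{n}_{z_0}[p](\varsigma_1,\dots,\varsigma_n,z)=\sum_{k=0}^{n}p_k(z)\binom{n}{k}^{-1}\sigma_k(\varsigma_1,\dots,\varsigma_n),$$ where $\sigma_k$ is the $k$-th elementary symmetric polynomial, $\sigma_0=1$; it is applied entrywise to matrix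 polynomials. Let $f=P/q\in\mathbb{R}\mathcal P_{d+1}^{m\times m}$, where $P$ is an $m\times m$ matrix polynomial in $(z_0,z)$ and $q\neq0$ is a scalar polynomial. Suppose that $P$ and $q$ are coprime, i.e. at least one entry of $P$ has no nonconstant common factor with $q$, and let $n_0=\deg_{z_0}f=\max(\deg_{z_0}P,\deg_{z_0}q)$, where $\deg_{z_0}P$ is the largest degree in $z_0$ of an entry of $P$. Then $D_{z_0}^{n_0}[q]\ne0$, the rational function $$\hat f(\varsigma_1,\dots,\varsigma_{n_0},z)=\frac{D_{z_0}^{n_0}[P(z_0,z)]}{D_{z_0}^{n_0}[q(z_0,z)]}$$ belongs to $\mathbb{R}\mathcal P_{d+n_0}^{m\times m}$, and $\hat f$ is affine in each of the variables $\varsigma_1,\dots,\varsigma_{n_0}$: for each $j$, the larger of the degrees in $\varsigma_j$ of the numerator $D_{z_0}^{n_0}[P]$ and of the denominator $D_{z_0}^{n_0}[q]$ equals $1$. -/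

import Mathlib

open scoped ComplexOrder

noncomputable section

namespace PosReal

/-- The open right poly-halfplane: all coordinates have positive real part. -/
def rightPolyHalfplane (σ : Type*) : Set (σ → ℂ) := {z | ∀ i, 0 < (z i).re}

/-- The value `P(z) / q(z)` of the rational matrix function `P / q` at a point `z`;
it is meaningful where `q(z) ≠ 0`, and is only used there. -/
def value {σ : Type*} {m : ℕ} (P : Matrix (Fin m) (Fin m) (MvPolynomial σ ℂ))
    (q : MvPolynomial σ ℂ) (z : σ → ℂ) : Matrix (Fin m) (Fin m) ℂ :=
  (MvPolynomial.eval z q)⁻¹ • P.map (MvPolynomial.eval z)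

/-- The rational `m × m` matrix function `f = P / q` in the variables indexed by `σ` is
(rational) positive real. All identities between values are required wherever both sides are
defined through `P / q`; as `{q ≠ 0}` is dense, this depends only on the function `f`. -/
structure IsPositiveReal {σ : Type*} [Fintype σ] {m : ℕ}
    (P : Matrix (Fin m) (Fin m) (MvPolynomial σ ℂ)) (q : MvPolynomial σ ℂ) : Prop where
  /-- `P / q` is a rational function. -/
  den_ne_zero : q ≠ 0
  /-- The complex conjugate of `f (conj z)` is `f z`. -/
  real : ∀ z : σ → ℂ, MvPolynomial.eval z q ≠ 0 → MvPolynomial.eval (star z) q ≠ 0 →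
    (value P q (star z)).map star = value P q z
  /-- `f z` is a symmetric matrix. -/
  symm : ∀ z : σ → ℂ, MvPolynomial.eval z q ≠ 0 →
    (value P q z).transpose = value P q z
  /-- `f (c z) = c f z` for all nonzero complex `c`. -/
  homogeneous : ∀ (c : ℂ) (z : σ → ℂ), c ≠ 0 → MvPolynomial.eval z q ≠ 0 →
    MvPolynomial.eval (c • z) q ≠ 0 → value P q (c • z) = c • value P q z
  /-- `f z + (f z)ᴴ ≥ 0` on the open right poly-halfplane. -/
  nonneg : ∀ z ∈ rightPolyHalfplane σ, MvPolynomial.eval z q ≠ 0 →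
    (value P q z + (value P q z).conjTranspose).PosSemidef
  /-- `f` is holomorphic on the open right poly-halfplane (after removing removable
  singularities, as usual for a rational function). -/
  holomorphic : ∃ F : (σ → ℂ) → Matrix (Fin m) (Fin m) ℂ,
    (∀ j k, DifferentiableOn ℂ (fun z => F z j k) (rightPolyHalfplane σ)) ∧
    ∀ z ∈ rightPolyHalfplane σ, MvPolynomial.eval z q ≠ 0 → F z = value P q z

/-- A matrix polynomial `P` and a scalar polynomial `q` are coprime if at least one entry of `P`
has no nonconstant common factor with `q`. -/
def Coprime {σ : Type*} {m : ℕ} (P : Matrix (Fin m) (Fin m) (MvPolynomial σ ℂ))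
    (q : MvPolynomial σ ℂ) : Prop :=
  ∃ j k, IsRelPrime (P j k) q

/-- The degree of a matrix polynomial in the variable `i`. -/
def matDegreeOf {σ : Type*} {m : ℕ} (i : σ) (P : Matrix (Fin m) (Fin m) (MvPolynomial σ ℂ)) : ℕ :=
  Finset.univ.sup fun jk : Fin m × Fin m => (P jk.1 jk.2).degreeOf i

/-- The degree of `P / q` in the variable `i`: the larger one of the degrees of the numerator
and of the denominator. -/
def fracDegreeOf {σ : Type*} {m : ℕ} (i : σ) (P : Matrix (Fin m) (Fin m) (MvPolynomial σ ℂ))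
    (q : MvPolynomial σ ℂ) : ℕ :=
  max (matDegreeOf i P) (q.degreeOf i)

/-- The degree reduction operator of order `n` in the first variable `z₀`: writing
`p = ∑ₖ pₖ(z₁, …, z_d) z₀ᵏ`, it replaces `z₀ᵏ` by `(n.choose k)⁻¹ σₖ(ς₁, …, ς_n)` for `k ≤ n`,
where `σₖ` is the elementary symmetric polynomial. The new variables `ς` are indexed by
`Sum.inl`, the remaining old variables `z₁, …, z_d` by `Sum.inr`. -/
def degreeReduction {d : ℕ} (n : ℕ) (p : MvPolynomial (Fin (d + 1)) ℂ) :
    MvPolynomial (Fin n ⊕ Fin d) ℂ :=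
  ∑ k ∈ Finset.range (n + 1),
    MvPolynomial.rename Sum.inr ((MvPolynomial.finSuccEquiv ℂ d p).coeff k) *
      (MvPolynomial.C ((n.choose k : ℂ)⁻¹) *
        MvPolynomial.rename Sum.inl (MvPolynomial.esymm (Fin n) ℂ k))

end PosReal

end

/-!
The degree reduction of a polynomial `p` of degree at most `n` in `z₀` is, for fixed values of the
other variables, its symmetric multiaffine polarization. By the Grace–Walsh–Szegő theorem for the
right half-plane (`polarize_ne_zero`), if `p` has no zeros in the open right poly-halfplane, then
neither has its degree reduction (`eval_degreeReduction_ne_zero`). Since the half-plane is convex,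
no lower bound on the degree of `p` is needed. The Grace–Walsh–Szegő theorem is obtained by
iterating Laguerre's theorem on polar derivatives (`eval_polarDerivative_ne_zero`): polarizing with
one point fixed at `ζ` amounts to polarizing the polar derivative with respect to `ζ`
(`polarize_cons`).

This is applied to `q` and to `xᴴ P x - s q` with `Re s < 0`. The latter has no zeros in the
poly-halfplane because `Re (xᴴ f x) ≥ 0` there, and the absence of zeros of its degree reduction
means that `xᴴ f̂ x` never takes a value in the open left half-plane
(`posSemidef_value_degreeReduction`).

That `q` has no zeros in the poly-halfplane is where holomorphy and coprimality enter
(`eval_ne_zero_of_continuousOn`). Let `p` be an entry of `P` coprime to `q`; as `p / q` extends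
continuously, `p` vanishes wherever `q` does. Elimination along the lines in a direction `v` with
`q v ≠ 0` produces a nonzero polynomial `r` with `r w = 0` for every line through `w` that meets a
common zero of `p` and `q`. If `q` vanished at a point `z`, every `w` close to `z` would lie on such
a line, by continuity of the roots of the polynomial `T ↦ q (w + T v)`, whose leading coefficient
is the constant `q v`; hence `r` would vanish on a neighbourhood of `z`, which is impossible.

The algebraic properties pass to the degree reduction because coprimality turns them from
identities between quotients into identities between polynomials
(`exists_eq_C_mul_of_cross_mul`): `P` and `q` are homogeneous of degrees `N + 1` and `N`, and
conjugating the coefficients multiplies both by the same constant.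
-/

namespace PosReal

/-! ### Polarization of univariate polynomials and the Grace–Walsh–Szegő theorem -/

section Polarization

open Polynomial

theorem esymm_cons_succ {R : Type*} [CommSemiring R] (a : R) (s : Multiset R) (k : ℕ) :
    (a ::ₘ s).esymm (k + 1) = s.esymm (k + 1) + a * s.esymm k := by
  simp [Multiset.esymm, Multiset.powersetCard_cons, Multiset.sum_map_mul_left]

theorem esymm_zero_right {R : Type*} [CommSemiring R] (s : Multiset R) : s.esymm 0 = 1 := by
  simp [Multiset.esymm]

theorem esymm_eq_zero_of_card_lt {R : Type*} [CommSemiring R] (s : Multiset R) {k : ℕ}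
    (h : s.card < k) : s.esymm k = 0 := by
  simp [Multiset.esymm, Multiset.powersetCard_eq_empty k h]

/-- The value at the multiset `s` of the symmetric multiaffine form obtained from the polynomial
`p`, regarded as a polynomial of degree at most `n`. -/
noncomputable def polarize (n : ℕ) (p : ℂ[X]) (s : Multiset ℂ) : ℂ :=
  ∑ k ∈ Finset.range (n + 1), p.coeff k * ((n.choose k : ℂ)⁻¹ * s.esymm k)

/-- The normalized polar derivative `p + (ζ - X) p' / n` of `p` with respect to `ζ`. -/
noncomputable def polarDerivative (n : ℕ) (ζ : ℂ) (p : ℂ[X]) : ℂ[X] :=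
  p + C (n : ℂ)⁻¹ * ((C ζ - X) * derivative p)

theorem coeff_polarDerivative (n : ℕ) (ζ : ℂ) (p : ℂ[X]) (k : ℕ) :
    (polarDerivative n ζ p).coeff k =
      p.coeff k + (n : ℂ)⁻¹ * (ζ * (p.coeff (k + 1) * (k + 1)) - p.coeff k * k) := by
  rw [polarDerivative, coeff_add, coeff_C_mul, sub_mul, coeff_sub, coeff_C_mul]
  cases k with
  | zero => simp [coeff_derivative]
  | succ k => simp [coeff_X_mul, coeff_derivative]

theorem natDegree_polarDerivative_le (n : ℕ) (ζ : ℂ) (p : ℂ[X]) (hp : p.natDegree ≤ n + 1) :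
    (polarDerivative (n + 1) ζ p).natDegree ≤ n := by
  rw [natDegree_le_iff_coeff_eq_zero]
  intro k hk
  have h1 : p.coeff (k + 1) = 0 := coeff_eq_zero_of_natDegree_lt (by omega)
  rw [coeff_polarDerivative, h1]
  rcases Nat.lt_or_ge (n + 1) k with h | h
  · rw [coeff_eq_zero_of_natDegree_lt (show p.natDegree < k by omega)]
    simp
  · obtain rfl : k = n + 1 := by omega
    have : ((n : ℂ) + 1) ≠ 0 := by exact_mod_cast Nat.succ_ne_zero n
    push_cast
    field_simp
    ring

/-- Fixing one argument `ζ` of the polarization of `p` gives the polarization of the polar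
derivative of `p` with respect to `ζ`. -/
theorem polarize_cons (n : ℕ) (ζ : ℂ) (p : ℂ[X]) (s : Multiset ℂ) (hs : s.card = n) :
    polarize (n + 1) p (ζ ::ₘ s) = polarize n (polarDerivative (n + 1) ζ p) s := by
  have hn : ((n : ℂ) + 1) ≠ 0 := by exact_mod_cast Nat.succ_ne_zero n
  have key : polarize (n + 1) p (ζ ::ₘ s) =
      ∑ k ∈ Finset.range (n + 2), p.coeff k * (((n + 1).choose k : ℂ)⁻¹ * s.esymm k) +
      ∑ k ∈ Finset.range (n + 1),
        p.coeff (k + 1) * (((n + 1).choose (k + 1) : ℂ)⁻¹ * (ζ * s.esymm k)) := by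
    rw [polarize, Finset.sum_range_succ', Finset.sum_range_succ' _ (n + 1), add_right_comm,
      ← Finset.sum_add_distrib]
    simp only [esymm_zero_right, esymm_cons_succ]
    congr 1
    exact Finset.sum_congr rfl fun k _ => by ring
  rw [key, Finset.sum_range_succ, esymm_eq_zero_of_card_lt s (by omega : s.card < n + 1)]
  simp only [mul_zero, add_zero]
  rw [polarize, ← Finset.sum_add_distrib]
  refine Finset.sum_congr rfl fun k hk => ?_
  have hk : k ≤ n := by simpa [Nat.lt_succ_iff] using hk
  have c0 : (n.choose k : ℂ) ≠ 0 := by exact_mod_cast (Nat.choose_pos hk).ne'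
  have c1 : ((n + 1).choose k : ℂ) ≠ 0 := by
    exact_mod_cast (Nat.choose_pos (hk.trans n.le_succ)).ne'
  have c2 : ((n + 1).choose (k + 1) : ℂ) ≠ 0 := by
    exact_mod_cast (Nat.choose_pos (Nat.succ_le_succ hk)).ne'
  have e1 : ((n + 1).choose k : ℂ)⁻¹ = (n + 1 - k) * (n + 1 : ℂ)⁻¹ * (n.choose k : ℂ)⁻¹ := by
    have := Nat.choose_mul_succ_eq n k
    have h : (n.choose k : ℂ) * (n + 1) = (n + 1).choose k * (n + 1 - k) := by
      rw [← Nat.cast_one, ← Nat.cast_add, ← Nat.cast_sub (hk.trans n.le_succ)]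
      exact_mod_cast this
    field_simp
    linear_combination h
  have e2 : ((n + 1).choose (k + 1) : ℂ)⁻¹ = (k + 1) * (n + 1 : ℂ)⁻¹ * (n.choose k : ℂ)⁻¹ := by
    have h : ((n : ℂ) + 1) * n.choose k = (n + 1).choose (k + 1) * (k + 1) := by
      exact_mod_cast Nat.add_one_mul_choose_eq n k
    field_simp
    linear_combination h
  rw [e1, e2, coeff_polarDerivative]
  push_cast
  field_simp
  ring

/-- The inversion `w ↦ w⁻¹` maps the half-plane `x ≤ Re w` into the disc `{w | x ‖w‖² ≤ Re w}`. -/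
theorem mul_norm_inv_sq_le_re_inv {x : ℝ} {w : ℂ} (hx : 0 < x) (hw : x ≤ w.re) :
    x * ‖w⁻¹‖ ^ 2 ≤ (w⁻¹).re := by
  have h0 : w ≠ 0 := by rintro rfl; simp at hw; linarith
  have hp : 0 < Complex.normSq w := Complex.normSq_pos.2 h0
  rw [Complex.inv_re, ← Complex.normSq_eq_norm_sq, map_inv₀, div_eq_mul_inv]
  gcongr

/-- The mean of a multiset of points of the disc `{w | x ‖w‖² ≤ Re w}` lies in this disc, by
convexity. -/
theorem norm_sum_sq_le {x : ℝ} (hx : 0 < x) (t : Multiset ℂ) (ht : ∀ w ∈ t, x * ‖w‖ ^ 2 ≤ w.re) :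
    x * ‖t.sum‖ ^ 2 ≤ t.card * t.sum.re := by
  induction t using Multiset.induction_on with
  | empty => simp
  | cons a t ih =>
    have ha := ht a (by simp)
    have ih := ih fun w hw => ht w (by simp [hw])
    simp only [Multiset.sum_cons, Multiset.card_cons, Complex.add_re]
    push_cast
    have h0 : 0 ≤ t.sum.re ∧ (t.card = 0 → t.sum = 0) := by
      constructor
      · rcases Nat.eq_zero_or_pos t.card with h | h
        · rw [Multiset.card_eq_zero.1 h]; simp
        · have : (0 : ℝ) < t.card := by exact_mod_cast h
          have : 0 ≤ (t.card : ℝ) * t.sum.re := le_trans (by positivity) ih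
          exact nonneg_of_mul_nonneg_right this ‹_›
      · intro h; rw [Multiset.card_eq_zero.1 h]; simp
    rcases Nat.eq_zero_or_pos t.card with h | h
    · rw [h, h0.2 h]; simpa using ha
    · have hc : (0 : ℝ) < t.card := by exact_mod_cast h
      rw [← Complex.normSq_eq_norm_sq, Complex.normSq_apply] at *
      simp only [Complex.add_re, Complex.add_im]
      generalize t.sum = b at *
      generalize (t.card : ℝ) = c at *
      have h1 : x * (b.re * b.re + b.im * b.im) / c ≤ b.re := by
        rw [div_le_iff₀ hc]; linarith
      have h2 : c * (x * (a.re * a.re + a.im * a.im)) ≤ c * a.re := by gcongr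
      -- up to a positive factor, the convexity defect of `‖·‖ ^ 2` between `a` and the mean `b / c`
      have h3 : 0 ≤ x / c * ((c * a.re - b.re) ^ 2 + (c * a.im - b.im) ^ 2) := by positivity
      have h4 : x / c * ((c * a.re - b.re) ^ 2 + (c * a.im - b.im) ^ 2) =
          c * (x * (a.re * a.re + a.im * a.im)) + x * (b.re * b.re + b.im * b.im) / c
            - 2 * x * (a.re * b.re + a.im * b.im) := by
        field_simp; ring
      nlinarith

/-- **Laguerre's theorem** for the right half-plane. At a zero `z` of the polar derivative,
`n / (z - ζ)` equals the logarithmic derivative `∑ 1 / (z - a)` over the roots `a` of `p`. The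
latter is a sum of at most `n` points of the disc onto which inversion maps the half-plane
`Re w ≥ Re z`, and this disc is convex and contains `0`, so `1 / (z - ζ)` lies in it. But `z - ζ`
lies outside this half-plane. -/
theorem eval_polarDerivative_ne_zero (n : ℕ) (hn : n ≠ 0) (p : ℂ[X]) (hdeg : p.natDegree ≤ n)
    (hp : ∀ z : ℂ, 0 < z.re → p.eval z ≠ 0) {ζ z : ℂ} (hζ : 0 < ζ.re) (hz : 0 < z.re) :
    (polarDerivative n ζ p).eval z ≠ 0 := by
  intro h
  have hpz := hp z hz
  have hn' : (n : ℂ) ≠ 0 := by exact_mod_cast hn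
  set S : Multiset ℂ := p.roots.map fun a => (z - a)⁻¹ with hS
  have hlog : p.derivative.eval z = p.eval z * S.sum := by
    have := (IsAlgClosed.splits p).eval_derivative_div_eval_of_ne_zero hpz
    simp only [one_div] at this
    rw [hS, ← this]; field_simp
  have hsum : (n : ℂ) = (z - ζ) * S.sum := by
    simp only [polarDerivative, eval_add, eval_mul, eval_C, eval_sub, eval_X, hlog] at h
    have : p.eval z * (n - (z - ζ) * S.sum) = 0 := by
      field_simp at h
      linear_combination h
    exact sub_eq_zero.1 ((mul_eq_zero.1 this).resolve_left hpz)
  have hbound : z.re * ‖S.sum‖ ^ 2 ≤ S.card * S.sum.re := by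
    refine norm_sum_sq_le hz S fun w hw => ?_
    obtain ⟨a, ha, rfl⟩ := Multiset.mem_map.1 hw
    refine mul_norm_inv_sq_le_re_inv hz ?_
    have : a.re ≤ 0 := by
      by_contra hlt
      exact hp a (not_le.1 hlt) (by simpa using (mem_roots'.1 ha).2)
    simp; linarith
  have hcard : (S.card : ℝ) ≤ n := by
    have : S.card ≤ n := by
      rw [hS, Multiset.card_map]; exact (card_roots' p).trans hdeg
    exact_mod_cast this
  have hne : S.sum ≠ 0 := by
    intro h0; rw [h0, mul_zero] at hsum; exact hn' hsum
  have hpos : 0 < ‖S.sum‖ ^ 2 := by positivity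
  have hre : 0 < S.sum.re := by
    have : 0 < (S.card : ℝ) * S.sum.re := lt_of_lt_of_le (by positivity) hbound
    exact pos_of_mul_pos_right this (by positivity)
  -- `n conj(S) = (z - ζ) |S|²`, whose real part is `(Re z - Re ζ) |S|²`
  have hre2 : (n : ℝ) * S.sum.re = (z.re - ζ.re) * ‖S.sum‖ ^ 2 := by
    have h1 := congrArg Complex.re hsum
    have h2 := congrArg Complex.im hsum
    simp at h1 h2
    rw [← Complex.normSq_eq_norm_sq, Complex.normSq_apply]
    linear_combination S.sum.re * h1 + S.sum.im * h2
  nlinarith [mul_le_mul_of_nonneg_right hcard hre.le]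

/-- The **Grace–Walsh–Szegő theorem** for the right half-plane, in its zero-free form. -/
theorem polarize_ne_zero (n : ℕ) (p : ℂ[X]) (hdeg : p.natDegree ≤ n)
    (hp : ∀ z : ℂ, 0 < z.re → p.eval z ≠ 0) (s : Multiset ℂ) (hs : s.card = n)
    (hpos : ∀ w ∈ s, 0 < w.re) : polarize n p s ≠ 0 := by
  induction n generalizing p s with
  | zero =>
    have h := hp 1 (by simp)
    rw [eq_C_of_natDegree_le_zero hdeg, eval_C] at h
    simpa [polarize, esymm_zero_right] using h
  | succ n ih =>
    obtain ⟨ζ, hζ⟩ := Multiset.card_pos_iff_exists_mem.1 (show 0 < s.card by omega)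
    obtain ⟨t, rfl⟩ := Multiset.exists_cons_of_mem hζ
    have ht : t.card = n := by simpa using hs
    rw [polarize_cons n ζ p t ht]
    exact ih _ (natDegree_polarDerivative_le n ζ p hdeg)
      (fun z hz => eval_polarDerivative_ne_zero (n + 1) n.succ_ne_zero p hdeg hp
        (hpos ζ (by simp)) hz) t ht fun w hw => hpos w (by simp [hw])

end Polarization

open MvPolynomial

variable {σ : Type*} {m d : ℕ}

/-! ### Degree reduction of multivariate polynomials -/

theorem degreeReduction_add (n : ℕ) (p q : MvPolynomial (Fin (d + 1)) ℂ) :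
    degreeReduction n (p + q) = degreeReduction n p + degreeReduction n q := by
  simp [degreeReduction, add_mul, Finset.sum_add_distrib]

theorem degreeReduction_C_mul (n : ℕ) (a : ℂ) (p : MvPolynomial (Fin (d + 1)) ℂ) :
    degreeReduction n (C a * p) = C a * degreeReduction n p := by
  simp [degreeReduction, Finset.mul_sum, finSuccEquiv_apply, mul_assoc]

theorem degreeReduction_sum {ι : Type*} (n : ℕ) (s : Finset ι)
    (p : ι → MvPolynomial (Fin (d + 1)) ℂ) :
    degreeReduction n (∑ i ∈ s, p i) = ∑ i ∈ s, degreeReduction n (p i) := by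
  induction s using Finset.cons_induction with
  | empty => simp [degreeReduction]
  | cons a s ha ih => rw [Finset.sum_cons, Finset.sum_cons, degreeReduction_add, ih]

theorem map_degreeReduction (n : ℕ) (φ : ℂ →+* ℂ) (p : MvPolynomial (Fin (d + 1)) ℂ) :
    map φ (degreeReduction n p) = degreeReduction n (map φ p) := by
  have h : ∀ k, (finSuccEquiv ℂ d (map φ p)).coeff k = map φ ((finSuccEquiv ℂ d p).coeff k) := by
    intro k
    ext m
    rw [coeff_map, finSuccEquiv_coeff_coeff, finSuccEquiv_coeff_coeff, coeff_map]
  simp [degreeReduction, h, map_rename, map_esymm]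

/-- The univariate polynomial in `z₀` obtained from `p` by fixing the remaining variables. -/
noncomputable def fiber (p : MvPolynomial (Fin (d + 1)) ℂ) (z : Fin d → ℂ) : Polynomial ℂ :=
  (finSuccEquiv ℂ d p).map (eval z)

theorem eval_fiber (p : MvPolynomial (Fin (d + 1)) ℂ) (z : Fin d → ℂ) (t : ℂ) :
    (fiber p z).eval t = eval (Fin.cons t z : Fin (d + 1) → ℂ) p :=
  (eval_eq_eval_mv_eval' z t p).symm

theorem natDegree_fiber_le (p : MvPolynomial (Fin (d + 1)) ℂ) (z : Fin d → ℂ) :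
    (fiber p z).natDegree ≤ p.degreeOf 0 :=
  Polynomial.natDegree_map_le.trans (natDegree_finSuccEquiv p).le

theorem eval_degreeReduction (n : ℕ) (p : MvPolynomial (Fin (d + 1)) ℂ) (z : Fin n ⊕ Fin d → ℂ) :
    eval z (degreeReduction n p) = polarize n (fiber p (z ∘ Sum.inr))
      (Finset.univ.val.map (z ∘ Sum.inl)) := by
  have h : ∀ k, eval (z ∘ Sum.inl) (esymm (Fin n) ℂ k) =
      (Finset.univ.val.map (z ∘ Sum.inl)).esymm k := fun k =>
    aeval_esymm_eq_multiset_esymm (Fin n) ℂ k (z ∘ Sum.inl)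
  simp [degreeReduction, polarize, fiber, eval_rename, h]

theorem esymm_isHomogeneous (n k : ℕ) : (esymm (Fin n) ℂ k).IsHomogeneous k := by
  refine IsHomogeneous.sum _ _ _ fun t ht => ?_
  have := IsHomogeneous.prod t (fun i => (X i : MvPolynomial (Fin n) ℂ)) (fun _ => 1)
    fun i _ => isHomogeneous_X ℂ i
  simpa [(Finset.mem_powersetCard.1 ht).2] using this

theorem degreeReduction_isHomogeneous {N : ℕ} (n : ℕ) {p : MvPolynomial (Fin (d + 1)) ℂ}
    (hp : p.IsHomogeneous N) : (degreeReduction n p).IsHomogeneous N := by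
  refine IsHomogeneous.sum _ _ _ fun k _ => ?_
  rcases le_or_gt k N with hk | hk
  · have h1 := (hp.finSuccEquiv_coeff_isHomogeneous k (N - k) (by omega)).rename_isHomogeneous
      (f := (Sum.inr : Fin d → Fin n ⊕ Fin d))
    have h2 := ((esymm_isHomogeneous n k).rename_isHomogeneous
      (f := (Sum.inl : Fin n → Fin n ⊕ Fin d))).C_mul ((n.choose k : ℂ)⁻¹)
    have := h1.mul h2
    rwa [Nat.sub_add_cancel hk] at this
  · have : (finSuccEquiv ℂ d p).coeff k = 0 := by
      ext m
      rw [finSuccEquiv_coeff_coeff, coeff_zero]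
      by_contra h
      have := hp h
      rw [Finsupp.weight_apply, Finsupp.sum_fintype _ _ (by simp), Fin.sum_univ_succ] at this
      simp at this
      omega
    rw [this]; simp [isHomogeneous_zero]

theorem eval_smul_of_isHomogeneous {N : ℕ} {p : MvPolynomial σ ℂ} (hp : p.IsHomogeneous N)
    (c : ℂ) (z : σ → ℂ) : eval (c • z) p = c ^ N * eval z p := by
  rw [eval_eq, eval_eq, Finset.mul_sum]
  refine Finset.sum_congr rfl fun m hm => ?_
  have : ∑ i ∈ m.support, m i = N := by
    have := hp (mem_support_iff.1 hm)
    rw [Finsupp.weight_apply] at this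
    simpa [Finsupp.sum] using this
  simp [mul_pow, Finset.prod_mul_distrib, Finset.prod_pow_eq_pow_sum, this]
  ring

theorem degreeOf_esymm_le (n k : ℕ) (i : Fin n) : (esymm (Fin n) ℂ k).degreeOf i ≤ 1 := by
  refine (degreeOf_sum_le _ _ _).trans (Finset.sup_le fun t _ => ?_)
  refine (degreeOf_prod_le _ _ _).trans ?_
  simp only [degreeOf_X]
  rw [Finset.sum_ite_eq]
  split_ifs <;> simp

theorem degreeOf_degreeReduction_le (n : ℕ) (p : MvPolynomial (Fin (d + 1)) ℂ) (i : Fin n) :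
    (degreeReduction n p).degreeOf (Sum.inl i) ≤ 1 := by
  refine (degreeOf_sum_le _ _ _).trans (Finset.sup_le fun k _ => ?_)
  refine (degreeOf_mul_le _ _ _).trans ?_
  have h1 : (rename (Sum.inr : Fin d → Fin n ⊕ Fin d)
      ((finSuccEquiv ℂ d p).coeff k)).degreeOf (Sum.inl i) = 0 := by
    classical
    by_contra h
    rw [← ne_eq, ← mem_vars_iff_degreeOf_ne_zero] at h
    obtain ⟨j, hj, hij⟩ := mem_vars_rename _ _ h
    simp at hij
  have h2 : (C ((n.choose k : ℂ)⁻¹) * rename (Sum.inl : Fin n → Fin n ⊕ Fin d)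
      (esymm (Fin n) ℂ k)).degreeOf (Sum.inl i) ≤ 1 := by
    refine (degreeOf_C_mul_le _ _ _).trans ?_
    rw [degreeOf_rename_of_injective Sum.inl_injective]
    exact degreeOf_esymm_le n k i
  omega

theorem esymm_replicate (n k : ℕ) (t : ℂ) :
    (Multiset.replicate n t).esymm k = n.choose k * t ^ k := by
  induction n generalizing k with
  | zero =>
    cases k with
    | zero => simp [esymm_zero_right]
    | succ k => simp [esymm_eq_zero_of_card_lt 0 (k := k + 1) (by simp)]
  | succ n ih =>
    cases k with
    | zero => simp [esymm_zero_right]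
    | succ k =>
      rw [Multiset.replicate_succ, esymm_cons_succ, ih, ih, Nat.choose_succ_succ]
      push_cast
      ring

theorem polarize_replicate (n : ℕ) (p : Polynomial ℂ) (hp : p.natDegree ≤ n) (t : ℂ) :
    polarize n p (Multiset.replicate n t) = p.eval t := by
  rw [polarize, Polynomial.eval_eq_sum_range' (Nat.lt_succ_of_le hp)]
  refine Finset.sum_congr rfl fun k hk => ?_
  have : (n.choose k : ℂ) ≠ 0 := by
    exact_mod_cast (Nat.choose_pos (Nat.lt_succ_iff.1 (Finset.mem_range.1 hk))).ne'
  rw [esymm_replicate]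
  field_simp

/-- On the diagonal `ς₁ = ⋯ = ςₙ = t`, degree reduction restores the original polynomial at `z₀ =
t`. -/
theorem eval_degreeReduction_diag (n : ℕ) (p : MvPolynomial (Fin (d + 1)) ℂ)
    (hp : p.degreeOf 0 ≤ n) (t : ℂ) (z : Fin d → ℂ) :
    eval (Sum.elim (fun _ => t) z) (degreeReduction n p) =
      eval (Fin.cons t z : Fin (d + 1) → ℂ) p := by
  have : Finset.univ.val.map (Sum.elim (fun _ : Fin n => t) z ∘ Sum.inl) =
      Multiset.replicate n t := by
    simp [Function.comp_def, Multiset.map_const']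
  rw [eval_degreeReduction, this, polarize_replicate _ _ ((natDegree_fiber_le _ _).trans hp)]
  simp [← eval_fiber]

theorem rename_degreeReduction (n : ℕ) (p : MvPolynomial (Fin (d + 1)) ℂ)
    (e : Equiv.Perm (Fin n)) :
    rename (Sum.map e id) (degreeReduction n p) = degreeReduction n p := by
  have h : ∀ k, rename (Sum.map e (id : Fin d → Fin d)) (rename Sum.inl (esymm (Fin n) ℂ k)) =
      rename Sum.inl (esymm (Fin n) ℂ k) := by
    intro k
    rw [rename_rename]
    conv_rhs => rw [← rename_esymm (Fin n) ℂ k e, rename_rename]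
    rfl
  have h' : ∀ r : MvPolynomial (Fin d) ℂ,
      rename (Sum.map e (id : Fin d → Fin d)) (rename (Sum.inr : Fin d → Fin n ⊕ Fin d) r) =
      rename Sum.inr r := by
    intro r
    rw [rename_rename]
    rfl
  simp [degreeReduction, h, h']

/-- If a new variable did not occur in the degree reduction, by symmetry none would, and restoring
`p` on the diagonal `ς₁ = ⋯ = ςₙ = z₀` would give a polynomial independent of `z₀`. -/
theorem degreeOf_degreeReduction (n : ℕ) (p : MvPolynomial (Fin (d + 1)) ℂ)
    (hp : p.degreeOf 0 = n) (i : Fin n) : (degreeReduction n p).degreeOf (Sum.inl i) = 1 := by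
  refine le_antisymm (degreeOf_degreeReduction_le n p i) ?_
  rw [Nat.one_le_iff_ne_zero]
  intro h0
  -- by symmetry, none of the new variables occurs
  have hall : ∀ j : Fin n, Sum.inl j ∉ (degreeReduction n p).vars := by
    intro j
    rw [mem_vars_iff_degreeOf_ne_zero, not_not, ← rename_degreeReduction n p (Equiv.swap i j)]
    have := degreeOf_rename_of_injective (p := degreeReduction n p)
      (Function.Injective.sumMap (Equiv.swap i j).injective
        (Function.injective_id (α := Fin d))) (Sum.inl i)
    simpa [h0] using this
  have hconst : ∀ (t : ℂ) (z : Fin d → ℂ), (fiber p z).eval t = (fiber p z).eval 0 := by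
    intro t z
    rw [eval_fiber, eval_fiber, ← eval_degreeReduction_diag n p hp.le,
      ← eval_degreeReduction_diag n p hp.le]
    refine eval₂Hom_congr' rfl ?_ rfl
    rintro (j | j) hj _
    · exact absurd hj (hall j)
    · rfl
  have hn : 0 < n := i.pos
  have hlead : (finSuccEquiv ℂ d p).coeff n = 0 := by
    refine MvPolynomial.funext fun z => ?_
    have : fiber p z = Polynomial.C ((fiber p z).eval 0) :=
      Polynomial.funext fun t => by rw [hconst t z, Polynomial.eval_C]
    have h := congrArg (fun r => Polynomial.coeff r n) this
    simpa [fiber, Polynomial.coeff_C, hn.ne'] using h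
  rw [← hp, ← natDegree_finSuccEquiv, Polynomial.coeff_natDegree,
    Polynomial.leadingCoeff_eq_zero] at hlead
  rw [← natDegree_finSuccEquiv, hlead] at hp
  simp at hp
  omega

theorem eval_degreeReduction_ne_zero (n : ℕ) (p : MvPolynomial (Fin (d + 1)) ℂ)
    (hp : p.degreeOf 0 ≤ n) (hne : ∀ z ∈ rightPolyHalfplane (Fin (d + 1)), eval z p ≠ 0) :
    ∀ z ∈ rightPolyHalfplane (Fin n ⊕ Fin d), eval z (degreeReduction n p) ≠ 0 := by
  intro z hz
  rw [eval_degreeReduction]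
  refine polarize_ne_zero n _ ((natDegree_fiber_le _ _).trans hp) ?_ _ (by simp) ?_
  · intro t ht
    rw [eval_fiber]
    refine hne _ fun i => ?_
    refine Fin.cases ?_ (fun j => ?_) i
    · simpa using ht
    · simpa using hz (Sum.inr j)
  · intro w hw
    obtain ⟨i, -, rfl⟩ := Multiset.mem_map.1 hw
    exact hz (Sum.inl i)

/-! ### Zeros of a denominator coprime to its numerator -/

/-- Substitution of `X i + T v i` for the variable `X i`: the restriction of a polynomial to the
lines in direction `v`, with parameter `T`. -/
noncomputable def shear (v : σ → ℂ) : MvPolynomial σ ℂ →ₐ[ℂ] Polynomial (MvPolynomial σ ℂ) :=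
  aeval fun i => Polynomial.C (X i) + Polynomial.C (C (v i)) * Polynomial.X

theorem eval_shear (v w : σ → ℂ) (t : ℂ) (p : MvPolynomial σ ℂ) :
    ((shear v p).map (eval w)).eval t = eval (w + t • v) p := by
  have : ((Polynomial.evalRingHom t).comp (Polynomial.mapRingHom (eval w))).comp
      (shear v : MvPolynomial σ ℂ →+* _) = eval (w + t • v) := by
    refine MvPolynomial.ringHom_ext (fun a => ?_) fun i => ?_
    · simp [shear, Polynomial.algebraMap_apply]
    · simp [shear]
      ring
  exact congrArg (fun φ : MvPolynomial σ ℂ →+* ℂ => φ p) this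

theorem natDegree_coeff_shear_prod (v : σ → ℂ) (e : σ → ℕ) (s : Finset σ) :
    (∏ i ∈ s, (Polynomial.C (X i) + Polynomial.C (C (v i)) * Polynomial.X) ^ e i :
      Polynomial (MvPolynomial σ ℂ)).natDegree ≤ ∑ i ∈ s, e i ∧
    (∏ i ∈ s, (Polynomial.C (X i) + Polynomial.C (C (v i)) * Polynomial.X) ^ e i :
      Polynomial (MvPolynomial σ ℂ)).coeff (∑ i ∈ s, e i) = C (∏ i ∈ s, v i ^ e i) := by
  induction s using Finset.cons_induction with
  | empty => simp
  | cons a s ha ih =>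
    have h1 : (Polynomial.C (X a) + Polynomial.C (C (v a)) * Polynomial.X :
        Polynomial (MvPolynomial σ ℂ)).natDegree ≤ 1 := by
      rw [add_comm]; exact Polynomial.natDegree_linear_le
    have h2 : ((Polynomial.C (X a) + Polynomial.C (C (v a)) * Polynomial.X :
        Polynomial (MvPolynomial σ ℂ)) ^ e a).natDegree ≤ e a := by
      simpa using Polynomial.natDegree_pow_le_of_le (e a) h1
    have h3 : ((Polynomial.C (X a) + Polynomial.C (C (v a)) * Polynomial.X :
        Polynomial (MvPolynomial σ ℂ)) ^ e a).coeff (e a) = C (v a ^ e a) := by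
      have := Polynomial.coeff_pow_of_natDegree_le (m := e a) h1
      rw [mul_one] at this
      rw [this]
      simp [Polynomial.coeff_C]
    rw [Finset.prod_cons, Finset.sum_cons, Finset.prod_cons]
    refine ⟨Polynomial.natDegree_mul_le_of_le h2 ih.1, ?_⟩
    rw [Polynomial.coeff_mul_add_eq_of_natDegree_le h2 ih.1, h3, ih.2, C_mul]

/-- As a polynomial in the parameter `T` of the lines in direction `v`, a homogeneous `q` of
degree `N` has the constant `q v` as its coefficient of `T ^ N`. -/
theorem natDegree_coeff_shear (v : σ → ℂ) {N : ℕ} {q : MvPolynomial σ ℂ}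
    (hq : q.IsHomogeneous N) :
    (shear v q).natDegree ≤ N ∧ (shear v q).coeff N = C (eval v q) := by
  have hN : ∀ m ∈ q.support, ∑ i ∈ m.support, m i = N := fun m hm => by
    have := hq (mem_support_iff.1 hm)
    rw [Finsupp.weight_apply] at this
    simpa [Finsupp.sum] using this
  have h : shear v q = ∑ m ∈ q.support, Polynomial.C (C (coeff m q)) *
      ∏ i ∈ m.support, (Polynomial.C (X i) + Polynomial.C (C (v i)) * Polynomial.X) ^ m i := by
    rw [shear, aeval_def, eval₂_eq]
    rfl
  rw [h]
  constructor
  · refine Polynomial.natDegree_sum_le_of_forall_le _ _ fun m hm => ?_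
    refine (Polynomial.natDegree_C_mul_le _ _).trans ?_
    rw [← hN m hm]
    exact (natDegree_coeff_shear_prod v m m.support).1
  · rw [Polynomial.finsetSum_coeff, eval_eq, map_sum]
    refine Finset.sum_congr rfl fun m hm => ?_
    rw [Polynomial.coeff_C_mul, C_mul, ← (natDegree_coeff_shear_prod v m m.support).2, hN m hm]

/-- Coprime polynomials over an integrally closed domain, one of them monic, have a nonzero constant
in the ideal they generate. By Gauss's lemma they stay coprime over the fraction field, so their
resultant does not vanish. -/
theorem exists_bezout_of_isRelPrime {R : Type*} [CommRing R] [IsDomain R] [IsIntegrallyClosed R]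
    {f g : Polynomial R} (hg : g.Monic) (h : IsRelPrime f g) :
    ∃ (a b : Polynomial R) (r : R), r ≠ 0 ∧ a * f + b * g = Polynomial.C r := by
  by_cases h0 : g.natDegree = 0
  · replace h0 := Polynomial.eq_one_of_monic_natDegree_zero hg h0
    exact ⟨0, 1, 1, one_ne_zero, by simp [h0]⟩
  obtain ⟨a, b, -, -, hab⟩ := Polynomial.exists_mul_add_mul_eq_C_resultant f g le_rfl le_rfl
    (Or.inr h0)
  refine ⟨a, b, f.resultant g, fun hr => ?_, by rw [← hab]; ring⟩
  set K := FractionRing R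
  have hinj : Function.Injective (algebraMap R K) := IsFractionRing.injective R K
  have hres : (f.map (algebraMap R K)).resultant (g.map (algebraMap R K)) = 0 := by
    rw [Polynomial.natDegree_map_eq_of_injective hinj,
      Polynomial.natDegree_map_eq_of_injective hinj, Polynomial.resultant_map_map, hr, map_zero]
  have hcop := (Polynomial.resultant_eq_zero_iff.1 hres).2
  rw [← isRelPrime_iff_isCoprime] at hcop
  refine hcop fun c hcf hcg => ?_
  obtain ⟨c', hc'⟩ := IsIntegrallyClosed.eq_map_mul_C_of_dvd K hg hcg
  have hc0 : c ≠ 0 := ne_zero_of_dvd_ne_zero (hg.map (algebraMap R K)).ne_zero hcg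
  have hu : IsUnit (Polynomial.C c.leadingCoeff) :=
    Polynomial.isUnit_C.2 (Polynomial.leadingCoeff_ne_zero.2 hc0).isUnit
  have hlead : algebraMap R K c'.leadingCoeff = 1 := by
    have := congrArg Polynomial.leadingCoeff hc'
    rw [Polynomial.leadingCoeff_mul, Polynomial.leadingCoeff_C,
      Polynomial.leadingCoeff_map_of_injective hinj] at this
    exact mul_right_cancel₀ (Polynomial.leadingCoeff_ne_zero.2 hc0) (by rw [this, one_mul])
  have hmon : c'.Monic := hinj (by rw [hlead, map_one])
  have hdvd : ∀ {x : Polynomial R}, c ∣ x.map (algebraMap R K) → c' ∣ x := fun hx =>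
    (Polynomial.map_dvd_map _ hinj hmon).1 ((Dvd.intro _ hc').trans hx)
  have := h (hdvd hcf) (hdvd hcg)
  rw [← hc']
  exact (this.map (Polynomial.mapRingHom (algebraMap R K))).mul hu

/-- The automorphism of `ℂ[X][T]` that fixes `T` and substitutes `X i + T v i` for `X i`. -/
noncomputable def shearHom (v : σ → ℂ) :
    Polynomial (MvPolynomial σ ℂ) →+* Polynomial (MvPolynomial σ ℂ) :=
  Polynomial.eval₂RingHom (shear v : MvPolynomial σ ℂ →+* _) Polynomial.X

theorem shearHom_shear (v : σ → ℂ) (p : MvPolynomial σ ℂ) :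
    shearHom (-v) (shear v p) = Polynomial.C p := by
  have : (shearHom (-v)).comp (shear v : MvPolynomial σ ℂ →+* _) = Polynomial.C := by
    refine MvPolynomial.ringHom_ext (fun a => ?_) fun i => ?_
    · simp [shearHom, shear, Polynomial.algebraMap_apply]
    · simp [shearHom, shear, Polynomial.algebraMap_apply, add_assoc, ← add_mul]
  exact congrArg (fun φ : MvPolynomial σ ℂ →+* _ => φ p) this

theorem shearHom_shearHom (v : σ → ℂ) (p : Polynomial (MvPolynomial σ ℂ)) :
    shearHom v (shearHom (-v) p) = p := by
  have : (shearHom v).comp (shearHom (-v)) = RingHom.id _ := by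
    refine Polynomial.ringHom_ext' (MvPolynomial.ringHom_ext (fun a => ?_) fun i => ?_) ?_
    · simp [shearHom, shear, Polynomial.algebraMap_apply]
    · simp [shearHom, shear, Polynomial.algebraMap_apply, add_assoc, ← add_mul]
    · simp [shearHom]
  exact congrArg (fun φ : Polynomial (MvPolynomial σ ℂ) →+* _ => φ p) this

/-- The inverse shear takes a common divisor of the sheared polynomials to a divisor of polynomials
that are constant in `T`, hence to a common divisor of `p` and `q`. -/
theorem isRelPrime_shear (v : σ → ℂ) {p q : MvPolynomial σ ℂ} (hq : q ≠ 0)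
    (h : IsRelPrime p q) : IsRelPrime (shear v p) (shear v q) := by
  intro c hp' hq'
  have h1 := map_dvd (shearHom (-v)) hp'
  have h2 := map_dvd (shearHom (-v)) hq'
  rw [shearHom_shear] at h1 h2
  have hdeg : (shearHom (-v) c).natDegree = 0 := by
    have := Polynomial.natDegree_le_of_dvd h2 (Polynomial.C_ne_zero.2 hq)
    simpa using this
  rw [Polynomial.eq_C_of_natDegree_eq_zero hdeg] at h1 h2
  have hu := h (by simpa using map_dvd Polynomial.constantCoeff h1)
    (by simpa using map_dvd Polynomial.constantCoeff h2)
  rw [← shearHom_shearHom v c, Polynomial.eq_C_of_natDegree_eq_zero hdeg]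
  exact (hu.map Polynomial.C).map (shearHom v)

/-- Elimination of the parameter of the lines in direction `v`: the polynomial `r` vanishes at every
`w` for which the line through `w` in direction `v` meets a common zero of `p` and `q`. -/
theorem exists_bezout_shear {N : ℕ} {p q : MvPolynomial σ ℂ} (hq : q.IsHomogeneous N)
    (h : IsRelPrime p q) {v : σ → ℂ} (hv : eval v q ≠ 0) :
    ∃ (a b : Polynomial (MvPolynomial σ ℂ)) (r : MvPolynomial σ ℂ), r ≠ 0 ∧
      a * shear v p + b * shear v q = Polynomial.C r := by
  have hq0 : q ≠ 0 := by rintro rfl; simp at hv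
  have hu : IsUnit (Polynomial.C (C (eval v q)⁻¹) : Polynomial (MvPolynomial σ ℂ)) :=
    ((isUnit_iff_ne_zero.2 (inv_ne_zero hv)).map C).map Polynomial.C
  have hmon : (Polynomial.C (C (eval v q)⁻¹) * shear v q).Monic := by
    refine Polynomial.monic_of_natDegree_le_of_coeff_eq_one N
      ((Polynomial.natDegree_C_mul_le _ _).trans (natDegree_coeff_shear v hq).1) ?_
    rw [Polynomial.coeff_C_mul, (natDegree_coeff_shear v hq).2, ← C_mul, inv_mul_cancel₀ hv, C_1]
  obtain ⟨a, b, r, hr, hab⟩ := exists_bezout_of_isRelPrime hmon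
    ((isRelPrime_mul_unit_left_right hu).2 (isRelPrime_shear v hq0 h))
  exact ⟨a, b * Polynomial.C (C (eval v q)⁻¹), r, hr, by rw [← hab]; ring⟩

theorem exists_eval_ne_zero_of_isOpen [Fintype σ] {r : MvPolynomial σ ℂ} (hr : r ≠ 0)
    {U : Set (σ → ℂ)} (hU : IsOpen U) (hne : U.Nonempty) : ∃ w ∈ U, eval w r ≠ 0 := by
  by_contra! h
  obtain ⟨z, hz⟩ := hne
  obtain ⟨ε, hε, hball⟩ := Metric.isOpen_iff.1 hU z hz
  refine hr (funext_set (fun i => Metric.ball (z i) ε) (fun i => ?_) fun x hx => ?_)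
  · exact infinite_of_mem_nhds (z i) (Metric.ball_mem_nhds _ hε)
  · rw [map_zero]
    rw [← ball_pi z hε] at hx
    exact h x (hball hx)

theorem isOpen_rightPolyHalfplane [Finite σ] : IsOpen (rightPolyHalfplane σ) := by
  have : rightPolyHalfplane σ = ⋂ i, {z : σ → ℂ | 0 < (z i).re} := by
    ext z; simp [rightPolyHalfplane]
  rw [this]
  exact isOpen_iInter_of_finite fun i =>
    isOpen_lt continuous_const (Complex.continuous_re.comp (continuous_apply i))

theorem pow_card_le_norm_prod {δ : ℝ} (hδ : 0 ≤ δ) (s : Multiset ℂ) (h : ∀ x ∈ s, δ ≤ ‖x‖) :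
    δ ^ s.card ≤ ‖s.prod‖ := by
  induction s using Multiset.induction_on with
  | empty => simp
  | cons a s ih =>
    rw [Multiset.card_cons, pow_succ', Multiset.prod_cons, norm_mul]
    exact mul_le_mul (h a (by simp)) (ih fun x hx => h x (by simp [hx])) (by positivity)
      (norm_nonneg a)

/-- A homogeneous polynomial that is small at `w` has a zero close to `w` on the line through `w`
in a noncharacteristic direction `v`. -/
theorem exists_zero_on_line {N : ℕ} {q : MvPolynomial σ ℂ} (hq : q.IsHomogeneous N)
    {v w : σ → ℂ} {δ : ℝ} (hδ : 0 ≤ δ) (hw : ‖eval w q‖ < ‖eval v q‖ * δ ^ N) :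
    ∃ t : ℂ, ‖t‖ < δ ∧ eval (w + t • v) q = 0 := by
  by_contra! h
  have hv : eval v q ≠ 0 := by
    intro h0; rw [h0, norm_zero, zero_mul] at hw; exact (norm_nonneg _).not_gt hw
  set G := (shear v q).map (eval w) with hG
  have hcoeff : G.coeff N = eval v q := by
    rw [hG, Polynomial.coeff_map, (natDegree_coeff_shear v hq).2, eval_C]
  have hdeg : G.natDegree = N :=
    Polynomial.natDegree_eq_of_le_of_coeff_ne_zero
      (Polynomial.natDegree_map_le.trans (natDegree_coeff_shear v hq).1) (by rwa [hcoeff])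
  have hsplit : G.Splits := IsAlgClosed.splits G
  have h0 := hsplit.eval_eq_prod_roots 0
  rw [hG, eval_shear, ← hG, Polynomial.leadingCoeff, hdeg, hcoeff] at h0
  have hcard : (G.roots.map (0 - ·)).card = N := by
    rw [Multiset.card_map, ← hdeg]; exact hsplit.natDegree_eq_card_roots.symm
  have hle := pow_card_le_norm_prod hδ (G.roots.map (0 - ·)) (by
    intro x hx
    obtain ⟨t, ht, rfl⟩ := Multiset.mem_map.1 hx
    have ht0 : G.eval t = 0 := (Polynomial.mem_roots'.1 ht).2
    rw [hG, eval_shear] at ht0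
    by_contra hlt
    exact h t (by simpa using hlt) ht0)
  rw [hcard] at hle
  have := congrArg norm h0
  rw [norm_mul] at this
  simp only [zero_smul, add_zero] at this
  rw [this] at hw
  exact absurd (mul_le_mul_of_nonneg_left hle (norm_nonneg (eval v q))) (not_le.2 hw)

/-- If `p` and `q` are coprime and `q` is homogeneous, then `p / q` does not extend continuously
to a zero of `q`. -/
theorem eval_ne_zero_of_continuousOn [Fintype σ] {N : ℕ} {p q : MvPolynomial σ ℂ}
    (hq : q.IsHomogeneous N) (hq0 : q ≠ 0) (h : IsRelPrime p q) {U : Set (σ → ℂ)} (hU : IsOpen U)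
    {F : (σ → ℂ) → ℂ} (hF : ContinuousOn F U)
    (hFq : ∀ z ∈ U, eval z q ≠ 0 → F z * eval z q = eval z p) :
    ∀ z ∈ U, eval z q ≠ 0 := by
  -- the identity `F q = p` extends to the zeros of `q`, whose complement is dense
  have hFq' : ∀ z ∈ U, F z * eval z q = eval z p := by
    intro z hz
    by_contra hne
    have hcont : ContinuousOn (fun z => F z * eval z q - eval z p) U :=
      (hF.mul (MvPolynomial.continuous_eval q).continuousOn).sub
        (MvPolynomial.continuous_eval p).continuousOn
    have hopen : IsOpen (U ∩ (fun z => F z * eval z q - eval z p) ⁻¹' {0}ᶜ) :=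
      hcont.isOpen_inter_preimage hU isOpen_compl_singleton
    obtain ⟨w, hw, hwq⟩ := exists_eval_ne_zero_of_isOpen hq0 hopen
      ⟨z, hz, fun h0 => hne (sub_eq_zero.1 h0)⟩
    exact hw.2 (sub_eq_zero.2 (hFq w hw.1 hwq))
  intro z hz hqz
  obtain ⟨v, -, hv⟩ := exists_eval_ne_zero_of_isOpen hq0 isOpen_univ Set.univ_nonempty
  obtain ⟨a, b, r, hr, hab⟩ := exists_bezout_shear hq h hv
  -- a neighbourhood of `z` and a bound for `t` such that `w + t v` stays in `U`
  have hmem : ∀ᶠ x : (σ → ℂ) × ℂ in nhds (z, 0), x.1 + x.2 • v ∈ U := by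
    have hc : Continuous fun x : (σ → ℂ) × ℂ => x.1 + x.2 • v := by fun_prop
    exact hc.continuousAt.preimage_mem_nhds (hU.mem_nhds (by simpa using hz))
  rw [nhds_prod_eq] at hmem
  obtain ⟨A, hA, B, hB, hAB⟩ := Filter.eventually_prod_iff.1 hmem
  obtain ⟨δ, hδ, hball⟩ := Metric.eventually_nhds_iff.1 hB
  have hsmall : ∀ᶠ w in nhds z, ‖eval w q‖ < ‖eval v q‖ * δ ^ N := by
    refine ((MvPolynomial.continuous_eval q).norm.tendsto z).eventually_lt_const ?_
    rw [hqz, norm_zero]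
    exact mul_pos (norm_pos_iff.2 hv) (pow_pos hδ N)
  obtain ⟨V, hV, hVopen, hzV⟩ := eventually_nhds_iff.1 (hA.and hsmall)
  obtain ⟨w, hwV, hwr⟩ := exists_eval_ne_zero_of_isOpen hr hVopen ⟨z, hzV⟩
  obtain ⟨t, ht, hqt⟩ := exists_zero_on_line hq hδ.le (hV w hwV).2
  have hpt : eval (w + t • v) p = 0 := by
    rw [← hFq' _ (hAB (hV w hwV).1 (hball (by simpa using ht))), hqt, mul_zero]
  have := congrArg (fun G : Polynomial (MvPolynomial σ ℂ) => (G.map (eval w)).eval t) hab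
  simp only [Polynomial.map_add, Polynomial.map_mul, Polynomial.eval_add, Polynomial.eval_mul,
    eval_shear, hqt, hpt, Polynomial.map_C, Polynomial.eval_C, mul_zero, add_zero] at this
  exact hwr this.symm

/-! ### Algebraic consequences of coprimality -/

theorem value_apply (P : Matrix (Fin m) (Fin m) (MvPolynomial σ ℂ)) (q : MvPolynomial σ ℂ)
    (z : σ → ℂ) (j k : Fin m) : value P q z j k = (eval z q)⁻¹ * eval z (P j k) := rfl

theorem exists_eq_C_mul_of_dvd {q q' : MvPolynomial σ ℂ} (hq : q ≠ 0) (h : q ∣ q')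
    (hdeg : q'.totalDegree ≤ q.totalDegree) : ∃ u, q' = C u * q := by
  obtain ⟨r, rfl⟩ := h
  rcases eq_or_ne r 0 with rfl | hr
  · exact ⟨0, by simp⟩
  rw [totalDegree_mul_of_isDomain hq hr] at hdeg
  have : r.totalDegree = 0 := by omega
  rw [totalDegree_eq_zero_iff_eq_C] at this
  exact ⟨r.coeff 0, by rw [← this, mul_comm]⟩

/-- A coprime representation `P / q` is unique up to a constant factor, among the representations
of `a • (P / q)` whose denominator has no larger degree. -/
theorem exists_eq_C_mul_of_cross_mul
    {P P' : Matrix (Fin m) (Fin m) (MvPolynomial σ ℂ)}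
    {q q' : MvPolynomial σ ℂ} {a : ℂ} (ha : a ≠ 0) (hq : q ≠ 0) (hcop : Coprime P q)
    (h : ∀ j k, P' j k * q = C a * P j k * q') (hdeg : q'.totalDegree ≤ q.totalDegree) :
    ∃ u, q' = C u * q ∧ ∀ j k, P' j k = C (a * u) * P j k := by
  obtain ⟨j, k, hjk⟩ := hcop
  have hdvd : q ∣ q' := by
    have h1 : q ∣ P j k * q' := by
      have h2 : q ∣ C a * (P j k * q') := ⟨P' j k, by rw [← mul_assoc, ← h, mul_comm]⟩
      exact ((isUnit_iff_ne_zero.2 ha).map C).dvd_mul_left.1 h2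
    exact hjk.symm.dvd_of_dvd_mul_left h1
  obtain ⟨u, rfl⟩ := exists_eq_C_mul_of_dvd hq hdvd hdeg
  refine ⟨u, rfl, fun j k => mul_right_cancel₀ hq ?_⟩
  rw [h, C_mul]
  ring

theorem eval_map_star (z : σ → ℂ) (p : MvPolynomial σ ℂ) :
    eval z (map (starRingEnd ℂ) p) = star (eval (star z) p) := by
  have : (eval z).comp (map (starRingEnd ℂ)) = (starRingEnd ℂ).comp (eval (star z)) := by
    refine MvPolynomial.ringHom_ext (fun a => ?_) fun i => ?_ <;> simp
  exact congrArg (fun φ : MvPolynomial σ ℂ →+* ℂ => φ p) this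

/-- Substitution of `c X i` for every variable `X i`. -/
noncomputable def scale (c : ℂ) : MvPolynomial σ ℂ →ₐ[ℂ] MvPolynomial σ ℂ :=
  aeval fun i => C c * X i

theorem eval_scale (c : ℂ) (z : σ → ℂ) (p : MvPolynomial σ ℂ) :
    eval z (scale c p) = eval (c • z) p := by
  have : (eval z).comp (scale c : MvPolynomial σ ℂ →ₐ[ℂ] _).toRingHom = eval (c • z) := by
    refine MvPolynomial.ringHom_ext (fun a => ?_) fun i => ?_ <;> simp [scale]
  exact congrArg (fun φ : MvPolynomial σ ℂ →+* ℂ => φ p) this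

theorem coeff_scale (c : ℂ) (p : MvPolynomial σ ℂ) (e : σ →₀ ℕ) :
    coeff e (scale c p) = c ^ e.degree * coeff e p := by
  classical
  induction p using MvPolynomial.induction_on' with
  | monomial e' a =>
    have : scale c (monomial e' a) = C (c ^ e'.degree) * monomial e' a := by
      rw [scale, aeval_monomial, algebraMap_eq]
      simp only [mul_pow, Finsupp.prod_mul]
      rw [monomial_eq, Finsupp.degree_apply]
      simp only [Finsupp.prod, Finset.prod_pow_eq_pow_sum, C_pow]
      ring
    rw [this, coeff_C_mul, coeff_monomial]
    split_ifs with h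
    · rw [h]
    · simp
  | add p q hp hq => rw [map_add, coeff_add, hp, hq, coeff_add, mul_add]

theorem isHomogeneous_of_scale_two {p : MvPolynomial σ ℂ} {N : ℕ}
    (h : scale 2 p = C (2 ^ N) * p) : p.IsHomogeneous N := by
  intro e he
  have h1 := congrArg (coeff e) h
  rw [coeff_scale, coeff_C_mul] at h1
  have h2 := mul_right_cancel₀ he h1
  have h3 : e.degree = N := by
    have : (2 : ℕ) ^ e.degree = 2 ^ N := by exact_mod_cast h2
    exact Nat.pow_right_injective le_rfl this
  rw [← h3, Finsupp.degree_eq_weight_one]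
  rfl

section

variable [Fintype σ] {P : Matrix (Fin m) (Fin m) (MvPolynomial σ ℂ)} {q : MvPolynomial σ ℂ}

theorem IsPositiveReal.transpose_eq (hf : IsPositiveReal P q) (j k : Fin m) : P j k = P k j := by
  refine mul_right_cancel₀ hf.den_ne_zero (MvPolynomial.funext fun z => ?_)
  rw [eval_mul, eval_mul]
  by_cases hz : eval z q = 0
  · simp [hz]
  · have := congrFun (congrFun (hf.symm z hz) k) j
    rw [Matrix.transpose_apply, value_apply, value_apply] at this
    rw [mul_left_cancel₀ (inv_ne_zero hz) this]

/-- For a coprime representation of a real `f`, conjugation of the coefficients multiplies the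
numerator and the denominator by the same constant. -/
theorem IsPositiveReal.exists_map_star_eq (hf : IsPositiveReal P q) (hcop : Coprime P q) :
    ∃ u : ℂ, u ≠ 0 ∧ map (starRingEnd ℂ) q = C u * q ∧
      ∀ j k, map (starRingEnd ℂ) (P j k) = C u * P j k := by
  have hinj := map_injective (σ := σ) (starRingEnd ℂ) (starRingEnd ℂ).injective
  have hq' : map (starRingEnd ℂ) q ≠ 0 := (map_ne_zero_iff _ hinj).2 hf.den_ne_zero
  obtain ⟨u, hu, hP⟩ := exists_eq_C_mul_of_cross_mul (a := 1)
    (P' := fun j k => map (starRingEnd ℂ) (P j k)) (q' := map (starRingEnd ℂ) q) one_ne_zero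
    hf.den_ne_zero hcop (fun j k => by
      -- after multiplication by both denominators the identity holds at every point
      refine mul_right_cancel₀ (mul_ne_zero hf.den_ne_zero hq') (MvPolynomial.funext fun z => ?_)
      simp only [eval_mul, eval_map_star, C_1, one_mul]
      by_cases h1 : eval z q = 0
      · simp [h1]
      by_cases h2 : eval (star z) q = 0
      · simp [h2]
      have := congrFun (congrFun (hf.real z h1 h2) j) k
      have h3 : star (eval (star z) q) ≠ 0 := by simpa using h2
      rw [Matrix.map_apply, value_apply, value_apply, star_mul', star_inv₀] at this
      field_simp at this
      rw [this]
      ring)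
    (totalDegree_le_of_support_subset (support_map_subset _ _))
  refine ⟨u, ?_, hu, fun j k => by rw [hP, one_mul]⟩
  rintro rfl
  exact hq' (by simp [hu])

/-- Homogeneity of `f` is used for the factor `2` only: a polynomial is homogeneous as soon as
scaling all variables by `2` multiplies it by a power of `2`. -/
theorem IsPositiveReal.exists_isHomogeneous (hf : IsPositiveReal P q) (hcop : Coprime P q) :
    ∃ N, q.IsHomogeneous N ∧ ∀ j k, (P j k).IsHomogeneous (N + 1) := by
  obtain ⟨e, he⟩ := ne_zero_iff.1 hf.den_ne_zero
  have hq' : scale 2 q ≠ 0 :=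
    ne_zero_iff.2 ⟨e, by rw [coeff_scale]; exact mul_ne_zero (by positivity) he⟩
  obtain ⟨u, hu, hP⟩ := exists_eq_C_mul_of_cross_mul (a := 2)
    (P' := fun j k => scale 2 (P j k)) (q' := scale 2 q) two_ne_zero
    hf.den_ne_zero hcop (fun j k => by
      -- after multiplication by both denominators the identity holds at every point
      refine mul_right_cancel₀ (mul_ne_zero hf.den_ne_zero hq') (MvPolynomial.funext fun z => ?_)
      simp only [eval_mul, eval_scale, eval_C]
      by_cases h1 : eval z q = 0
      · simp [h1]
      by_cases h2 : eval ((2 : ℂ) • z) q = 0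
      · simp [h2]
      have := congrFun (congrFun (hf.homogeneous 2 z two_ne_zero h1 h2) j) k
      rw [Matrix.smul_apply, value_apply, value_apply, smul_eq_mul] at this
      field_simp at this
      linear_combination (eval z q * eval ((2 : ℂ) • z) q) * this)
    (totalDegree_le_of_support_subset fun e he => by
      rw [mem_support_iff, coeff_scale] at he
      exact mem_support_iff.2 (right_ne_zero_of_mul he))
  have hu' : u = 2 ^ e.degree := by
    have := congrArg (coeff e) hu
    rw [coeff_scale, coeff_C_mul] at this
    exact (mul_right_cancel₀ he this).symm
  refine ⟨e.degree, isHomogeneous_of_scale_two (by rw [hu, hu']), fun j k =>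
    isHomogeneous_of_scale_two ?_⟩
  rw [hP, hu', pow_succ']

theorem IsPositiveReal.eval_den_ne_zero (hf : IsPositiveReal P q) (hcop : Coprime P q) :
    ∀ z ∈ rightPolyHalfplane σ, eval z q ≠ 0 := by
  obtain ⟨N, hN, -⟩ := hf.exists_isHomogeneous hcop
  obtain ⟨j, k, hjk⟩ := hcop
  obtain ⟨F, hF, hFv⟩ := hf.holomorphic
  refine eval_ne_zero_of_continuousOn hN hf.den_ne_zero hjk isOpen_rightPolyHalfplane
    (hF j k).continuousOn fun z hz hqz => ?_
  rw [hFv z hz hqz, value_apply]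
  field_simp

end

/-! ### Positivity and the degree reduction of positive real functions -/

theorem posSemidef_add_conjTranspose_iff (A : Matrix (Fin m) (Fin m) ℂ) :
    (A + A.conjTranspose).PosSemidef ↔
      ∀ x : Fin m → ℂ, 0 ≤ (dotProduct (star x) (A.mulVec x)).re := by
  have key : ∀ x : Fin m → ℂ, dotProduct (star x) ((A + A.conjTranspose).mulVec x) =
      ((2 * (dotProduct (star x) (A.mulVec x)).re : ℝ) : ℂ) := by
    intro x
    have : dotProduct (star x) (A.conjTranspose.mulVec x) =
        star (dotProduct (star x) (A.mulVec x)) := by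
      rw [Matrix.dotProduct_mulVec, ← Matrix.star_mulVec, Matrix.star_dotProduct]
    rw [Matrix.add_mulVec, dotProduct_add, this]
    exact Complex.add_conj _
  rw [Matrix.posSemidef_iff_dotProduct_mulVec]
  constructor
  · intro h x
    have := h.2 x
    rw [key, Complex.zero_le_real] at this
    linarith
  · intro h
    refine ⟨?_, fun x => ?_⟩
    · rw [Matrix.IsHermitian, Matrix.conjTranspose_add, Matrix.conjTranspose_conjTranspose,
        add_comm]
    · rw [key, Complex.zero_le_real]
      linarith [h x]

/-- The polynomial `xᴴ P x` for a matrix polynomial `P` and a constant vector `x`. -/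
noncomputable def quadForm (P : Matrix (Fin m) (Fin m) (MvPolynomial σ ℂ)) (x : Fin m → ℂ) :
    MvPolynomial σ ℂ :=
  ∑ j, ∑ k, C (star (x j) * x k) * P j k

theorem eval_quadForm (P : Matrix (Fin m) (Fin m) (MvPolynomial σ ℂ)) {q : MvPolynomial σ ℂ}
    (x : Fin m → ℂ) {z : σ → ℂ} (hz : eval z q ≠ 0) :
    eval z (quadForm P x) = eval z q * dotProduct (star x) ((value P q z).mulVec x) := by
  simp only [quadForm, map_sum, eval_mul, eval_C, dotProduct, Matrix.mulVec, value_apply,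
    Finset.mul_sum, Pi.star_apply]
  refine Finset.sum_congr rfl fun j _ => Finset.sum_congr rfl fun k _ => ?_
  field_simp

theorem degreeReduction_quadForm (n : ℕ)
    (P : Matrix (Fin m) (Fin m) (MvPolynomial (Fin (d + 1)) ℂ)) (x : Fin m → ℂ) :
    degreeReduction n (quadForm P x) = quadForm (P.map (degreeReduction n)) x := by
  simp only [quadForm, degreeReduction_sum, degreeReduction_C_mul, Matrix.map_apply]

theorem degreeOf_le_matDegreeOf (i : σ) (P : Matrix (Fin m) (Fin m) (MvPolynomial σ ℂ))
    (j k : Fin m) : (P j k).degreeOf i ≤ matDegreeOf i P :=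
  Finset.le_sup (f := fun jk : Fin m × Fin m => (P jk.1 jk.2).degreeOf i) (Finset.mem_univ (j, k))

theorem degreeOf_quadForm_le (i : σ) (P : Matrix (Fin m) (Fin m) (MvPolynomial σ ℂ))
    (x : Fin m → ℂ) : (quadForm P x).degreeOf i ≤ matDegreeOf i P :=
  (degreeOf_sum_le _ _ _).trans <| Finset.sup_le fun j _ =>
    (degreeOf_sum_le _ _ _).trans <| Finset.sup_le fun k _ =>
      (degreeOf_C_mul_le _ _ _).trans (degreeOf_le_matDegreeOf i P j k)

theorem posSemidef_value_degreeReduction {n : ℕ}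
    {P : Matrix (Fin m) (Fin m) (MvPolynomial (Fin (d + 1)) ℂ)}
    {q : MvPolynomial (Fin (d + 1)) ℂ} (hf : IsPositiveReal P q)
    (hq : ∀ z ∈ rightPolyHalfplane (Fin (d + 1)), eval z q ≠ 0)
    (hdeg : fracDegreeOf 0 P q ≤ n) {z : Fin n ⊕ Fin d → ℂ}
    (hz : z ∈ rightPolyHalfplane (Fin n ⊕ Fin d)) :
    (value (P.map (degreeReduction n)) (degreeReduction n q) z +
      (value (P.map (degreeReduction n)) (degreeReduction n q) z).conjTranspose).PosSemidef := by
  have hdP : matDegreeOf 0 P ≤ n := (le_max_left _ _).trans hdeg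
  have hdq : q.degreeOf 0 ≤ n := (le_max_right _ _).trans hdeg
  have hDq := eval_degreeReduction_ne_zero n q hdq hq z hz
  rw [posSemidef_add_conjTranspose_iff]
  intro x
  by_contra! hneg
  set s := dotProduct (star x)
    ((value (P.map (degreeReduction n)) (degreeReduction n q) z).mulVec x) with hs
  -- `xᴴ P x - s q` has no zeros in the poly-halfplane because `Re s < 0`
  have hne : ∀ w ∈ rightPolyHalfplane (Fin (d + 1)),
      eval w (quadForm P x + C (-s) * q) ≠ 0 := by
    intro w hw h0
    have hqw := hq w hw
    have hre := (posSemidef_add_conjTranspose_iff _).1 (hf.nonneg w hw hqw) x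
    rw [eval_add, eval_quadForm P x hqw, eval_mul, eval_C] at h0
    have h1 : eval w q * (dotProduct (star x) ((value P q w).mulVec x) - s) = 0 := by
      linear_combination h0
    rw [sub_eq_zero.1 ((mul_eq_zero.1 h1).resolve_left hqw)] at hre
    exact absurd hre (not_le.2 hneg)
  have hdegree : (quadForm P x + C (-s) * q).degreeOf 0 ≤ n :=
    (degreeOf_add_le _ _ _).trans (max_le ((degreeOf_quadForm_le _ _ _).trans hdP)
      ((degreeOf_C_mul_le _ _ _).trans hdq))
  refine eval_degreeReduction_ne_zero n _ hdegree hne z hz ?_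
  rw [degreeReduction_add, degreeReduction_C_mul, degreeReduction_quadForm, eval_add,
    eval_quadForm _ x hDq, eval_mul, eval_C, ← hs]
  ring

theorem differentiable_eval [Fintype σ] (p : MvPolynomial σ ℂ) :
    Differentiable ℂ fun z : σ → ℂ => eval z p := fun z =>
  ((AnalyticOnNhd.eval_mvPolynomial (𝕜 := ℂ) p) z (Set.mem_univ z)).differentiableAt

theorem isPositiveReal_degreeReduction {n : ℕ}
    {P : Matrix (Fin m) (Fin m) (MvPolynomial (Fin (d + 1)) ℂ)}
    {q : MvPolynomial (Fin (d + 1)) ℂ} (hf : IsPositiveReal P q) (hcop : Coprime P q)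
    (hdeg : fracDegreeOf 0 P q ≤ n) :
    IsPositiveReal (P.map (degreeReduction n)) (degreeReduction n q) := by
  have hq := hf.eval_den_ne_zero hcop
  have hDq := eval_degreeReduction_ne_zero n q ((le_max_right _ _).trans hdeg) hq
  obtain ⟨u, hu, huq, huP⟩ := hf.exists_map_star_eq hcop
  obtain ⟨N, hN, hNP⟩ := hf.exists_isHomogeneous hcop
  refine ⟨?_, ?_, ?_, ?_, ?_, ?_⟩
  · intro h0
    exact hDq (fun _ => 1) (fun _ => by simp) (by simp [h0])
  · intro z h1 h2
    have hstar : ∀ p : MvPolynomial (Fin (d + 1)) ℂ, map (starRingEnd ℂ) p = C u * p →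
        star (eval (star z) (degreeReduction n p)) =
          u * eval z (degreeReduction n p) := by
      intro p hp
      rw [← eval_map_star, map_degreeReduction, hp, degreeReduction_C_mul, eval_mul, eval_C]
    ext j k
    rw [Matrix.map_apply, value_apply, value_apply, star_mul', star_inv₀, Matrix.map_apply,
      hstar q huq, hstar (P j k) (huP j k)]
    field_simp
  · intro z _
    ext j k
    rw [Matrix.transpose_apply, value_apply, value_apply, Matrix.map_apply, Matrix.map_apply,
      hf.transpose_eq]
  · intro c z hc h1 _
    ext j k
    rw [Matrix.smul_apply, value_apply, value_apply, Matrix.map_apply,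
      eval_smul_of_isHomogeneous (degreeReduction_isHomogeneous n hN),
      eval_smul_of_isHomogeneous (degreeReduction_isHomogeneous n (hNP j k)), smul_eq_mul]
    field_simp
    ring
  · intro z hz _
    exact posSemidef_value_degreeReduction hf hq hdeg hz
  · refine ⟨value (P.map (degreeReduction n)) (degreeReduction n q),
      fun j k => ?_, fun _ _ _ => rfl⟩
    simp only [value_apply]
    exact (differentiable_eval _).differentiableOn.inv hDq |>.mul
      (differentiable_eval _).differentiableOn

theorem fracDegreeOf_degreeReduction {n : ℕ}
    {P : Matrix (Fin m) (Fin m) (MvPolynomial (Fin (d + 1)) ℂ)}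
    {q : MvPolynomial (Fin (d + 1)) ℂ} (hdeg : fracDegreeOf 0 P q = n) (i : Fin n) :
    fracDegreeOf (Sum.inl i) (P.map (degreeReduction n)) (degreeReduction n q) = 1 := by
  refine le_antisymm (max_le (Finset.sup_le fun jk _ => degreeOf_degreeReduction_le n _ i)
    (degreeOf_degreeReduction_le n q i)) ?_
  rcases max_choice (matDegreeOf 0 P) (q.degreeOf 0) with h | h
  · have hP : matDegreeOf 0 P = n := h.symm.trans hdeg
    obtain ⟨⟨j, k⟩, -, hjk⟩ := Finset.exists_mem_eq_sup' (s := Finset.univ (α := Fin m × Fin m))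
      (by
        by_contra hne
        rw [Finset.not_nonempty_iff_eq_empty] at hne
        rw [matDegreeOf, hne, Finset.sup_empty] at hP
        exact i.pos.ne hP)
      (fun jk => (P jk.1 jk.2).degreeOf 0)
    rw [Finset.sup'_eq_sup] at hjk
    refine le_trans ?_ (le_max_left _ _)
    exact (degreeOf_degreeReduction n (P j k) (hjk.symm.trans hP) i).symm.le.trans
      (degreeOf_le_matDegreeOf _ (P.map (degreeReduction n)) j k)
  · refine le_trans ?_ (le_max_right _ _)
    rw [degreeOf_degreeReduction n q (h.symm.trans hdeg) i]

end PosReal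

theorem theorem3p4 (d m n₀ : ℕ)
    (P : Matrix (Fin m) (Fin m) (MvPolynomial (Fin (d + 1)) ℂ))
    (q : MvPolynomial (Fin (d + 1)) ℂ)
    (hf : PosReal.IsPositiveReal P q)
    (hcop : PosReal.Coprime P q)
    (hdeg : PosReal.fracDegreeOf 0 P q = n₀) :
    PosReal.IsPositiveReal (P.map (PosReal.degreeReduction n₀)) (PosReal.degreeReduction n₀ q) ∧
      ∀ i : Fin n₀, PosReal.fracDegreeOf (Sum.inl i)
        (P.map (PosReal.degreeReduction n₀)) (PosReal.degreeReduction n₀ q) = 1 := by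
  exact ⟨PosReal.isPositiveReal_degreeReduction hf hcop hdeg.le,
    PosReal.fracDegreeOf_degreeReduction hdeg⟩
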